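/- Consider a two-armed Bernoulli bandit with means $\mu_1,\mu_2\in(0,1)$, $\mu_2<\mu_1$: at each round $t=1,2,\dots$ an arm $A_t\in\{1,2\}$ is pulled and a reward $R_t\in\{0,1\}$ is observed which, given $A_1,R_1,\dots,A_{t-1},R_{t-1},A_t$, is Bernoulli with mean $\mu_{A_t}$. For $a\in\{1,2\}$ let $N_a(t)=\#\{i<t : A_i=a\}$ and let $\hat\mu_a(t)$ be the average of the rewards received from arm $a$ in rounds $1,\dots,t-1$. Assume that $(A_t)$ is chosen by UCB, i.e. almost surely, for every $t\ge 1$, $A_t$ maximizes the index $$ I_a(t)=\hat\mu_a(t)+\sqrt{\frac{2\log t}{N_a(t)}}\qquad(I_a(t)=+\infty \text{ if } N_a(t)=0) $$ over $a\in\{1,2\}$, ties being broken arbitrarily. For $s\ge1$ and an integer $T\ge 1$ let $\mathrm{Reg}(s;s+T)=T\mu_1-\sum_{i=0}^{T-1}\mu_{A_{s+i}}$ be the pseudo-regret over the $T$ rounds $s,\dots,s+T-1$; it is always at most $(\mu_1-\mu_2)T$. **Proposition.** For every integer $T\ge 1$ there is an increasing sequence $(\sigma_k)_{k\ge1}$ of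 $\{1,2,\dots\}\cup\{\infty\}$-valued stopping times for the filtration $\mathcal H_t=\sigma(A_1,R_1,\dots,A_{t-1},R_{t-1})$, strictly increasing as long as finite ($\sigma_k<\sigma_{k+1}$ whenever $\sigma_k<\infty$), such that for every $k$ one has $\sigma_k<\infty$ almost surely and $$ \mathbb P\big(\mathrm{Reg}(\sigma_k;\sigma_k+T)=(\mu_1-\mu_2)T\big)=1 . $$ Moreover this holds regardless of the rewards observed from round $\sigma_k$ on: for every $k$, almost surely, every sequence $(a_t,r_t)_{t\ge1}$ in $\{1,2\}\times\{0,1\}$ that coincides with $(A_t,R_t)$ for all $t<\sigma_k$ and in which every $a_t$ maximizes the UCB index computed from $(a_i,r_i)_{i<t}$ satisfies $T\mu_1-\sum_{i=0}^{T-1}\mu_{a_{\sigma_k+i}}=(\mu_1-\mu_2)T$. -/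

import Mathlib

open MeasureTheory

namespace Bandit

/-- `visits a b t` is `N_b(t)`: the number of pulls of arm `b` at the times `1, …, t - 1`, along the
sequence of actions `a`. Time starts at `1`; the value of a sequence at `0` is never used. -/
def visits (a : ℕ → Fin 2) (b : Fin 2) (t : ℕ) : ℕ :=
  ((Finset.Ico 1 t).filter fun i => a i = b).card

/-- `successes a r b t` is `S_b(t)`: the number of the pulls of arm `b` at the times `1, …, t - 1`
whose reward is one (a Bernoulli reward is a `Bool`, with `true` for the reward one). -/
def successes (a : ℕ → Fin 2) (r : ℕ → Bool) (b : Fin 2) (t : ℕ) : ℕ :=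
  ((Finset.Ico 1 t).filter fun i => a i = b ∧ r i = true).card

/-- The empirical mean of arm `b` at time `t` (only used when `visits a b t ≠ 0`). -/
noncomputable def empMean (a : ℕ → Fin 2) (r : ℕ → Bool) (b : Fin 2) (t : ℕ) : ℝ :=
  (successes a r b t : ℝ) / (visits a b t : ℝ)

/-- The UCB index of arm `b` at time `t`, equal to `+∞` as long as `b` has not been pulled. -/
noncomputable def ucbIndex (a : ℕ → Fin 2) (r : ℕ → Bool) (b : Fin 2) (t : ℕ) : EReal :=
  if visits a b t = 0 then ⊤
  else ((empMean a r b t + Real.sqrt (2 * Real.log (t : ℝ) / (visits a b t : ℝ)) : ℝ) : EReal)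

/-- Along the trajectory `(a, r)`, every action maximizes the UCB index (ties are broken
arbitrarily). -/
def FollowsUCB (a : ℕ → Fin 2) (r : ℕ → Bool) : Prop :=
  ∀ t : ℕ, 1 ≤ t → ∀ b : Fin 2, ucbIndex a r b t ≤ ucbIndex a r (a t) t

/-- The pseudo-regret `Reg(s; s + T)` over the `T` rounds `s, …, s + T - 1`, where arm `0` is the
optimal arm. -/
noncomputable def pseudoRegret (μ : Fin 2 → ℝ) (a : ℕ → Fin 2) (s T : ℕ) : ℝ :=
  (T : ℝ) * μ 0 - ∑ i ∈ Finset.range T, μ (a (s + i))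

variable {Ω : Type*} [mΩ : MeasurableSpace Ω]

/-- The history filtration: the σ-algebra at time `t` is generated by the observations
`A_1, R_1, …, A_{t-1}, R_{t-1}` made before round `t`. -/
def history (A : ℕ → Ω → Fin 2) (R : ℕ → Ω → Bool)
    (hA : ∀ t, Measurable (A t)) (hR : ∀ t, Measurable (R t)) : Filtration ℕ mΩ where
  seq t := ⨆ i ∈ Finset.Ico 1 t,
    (MeasurableSpace.comap (A i) inferInstance ⊔ MeasurableSpace.comap (R i) inferInstance)
  mono' s t hst := biSup_mono fun i hi => by
    simp only [Finset.mem_Ico] at hi ⊢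
    omega
  le' t := iSup₂_le fun i _ => sup_le (hA i).comap_le (hR i).comap_le

/-- `(A, R)` is a run of UCB on the two-armed Bernoulli bandit with means `μ`: almost surely every
action maximizes the UCB index, and given the history and the arm `A_t` just chosen, the reward
`R_t` is Bernoulli with mean `μ_{A_t}`. -/
structure IsUCBRun (P : Measure Ω) (μ : Fin 2 → ℝ) (A : ℕ → Ω → Fin 2) (R : ℕ → Ω → Bool)
    (hA : ∀ t, Measurable (A t)) (hR : ∀ t, Measurable (R t)) : Prop where
  follows : ∀ᵐ ω ∂P, FollowsUCB (fun t => A t ω) (fun t => R t ω)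
  reward_law : ∀ t : ℕ, 1 ≤ t →
    P[Set.indicator {ω | R t ω = true} (fun _ => (1 : ℝ)) |
        history A R hA hR t ⊔ MeasurableSpace.comap (A t) inferInstance]
      =ᵐ[P] fun ω => μ (A t ω)

end Bandit

/-! Just after UCB switches from arm `0` to arm `1`, the two indices are nearly tied, so a lead of
order `1/n`, with `n` the number of pulls of arm `1`, decides any fixed number of further rounds. At
such a switch arm `0` holds about half of the pulls or more, so its bonus is negligible. By the law
of large numbers the mean `p` of arm `1` is then close to `μ 1`, and its bonus `β` is at most about
`μ 0 - μ 1`. To first order a success of arm `1` raises its index by `(1 - p - β/2)/n`, where the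
bracket is at least about `1 - (μ 0 + μ 1)/2 > 0`, while a failure costs `(p + β/2)/n`, at most
`3/(2n)`. Meanwhile the index of the unpulled arm `0` drifts only by `O(1/(t √log t)) = o(1/n)`.
Hence `M` successes in a row, with `M` large compared with `T`, build a lead that no `T` further
rewards can undo: `GoodStart.action_eq_one`, `WinningRun.certified`.

Switches recur because UCB pulls both arms infinitely often (`FollowsUCB.tendsto_visits`). Runs of
`M` successes after a switch recur by `M` applications of the conditional Borel–Cantelli lemma
(`IsUCBRun.ae_frequently_winningRun`). The law of large numbers comes from nonnegative betting
martingales (`IsUCBRun.ae_tendsto_empMean`). The stopping times enumerate the rounds at which every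
UCB continuation of the past is forced onto arm `1`; this property, `Certified`, depends on the past
alone. -/

open Filter Topology

namespace Bandit

/-! ### Deterministic analysis of UCB trajectories: counting pulls and successes -/

section Trajectory

variable {a a' : ℕ → Fin 2} {r r' : ℕ → Bool} {b : Fin 2} {t : ℕ}

/-- The exploration bonus of arm `b` at time `t`. -/
noncomputable def bonus (a : ℕ → Fin 2) (b : Fin 2) (t : ℕ) : ℝ :=
  Real.sqrt (2 * Real.log (t : ℝ) / (visits a b t : ℝ))

lemma bonus_nonneg (a : ℕ → Fin 2) (b : Fin 2) (t : ℕ) : 0 ≤ bonus a b t := Real.sqrt_nonneg _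

lemma visits_congr (h : ∀ i, 1 ≤ i → i < t → a i = a' i) : visits a b t = visits a' b t := by
  unfold visits
  congr 1
  refine Finset.filter_congr fun i hi => ?_
  rw [Finset.mem_Ico] at hi
  rw [h i hi.1 hi.2]

lemma successes_congr (h : ∀ i, 1 ≤ i → i < t → a i = a' i)
    (h' : ∀ i, 1 ≤ i → i < t → r i = r' i) : successes a r b t = successes a' r' b t := by
  unfold successes
  congr 1
  refine Finset.filter_congr fun i hi => ?_
  rw [Finset.mem_Ico] at hi
  rw [h i hi.1 hi.2, h' i hi.1 hi.2]

lemma visits_succ (a : ℕ → Fin 2) (b : Fin 2) (ht : 1 ≤ t) :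
    visits a b (t + 1) = visits a b t + if a t = b then 1 else 0 := by
  unfold visits
  rw [← Finset.insert_Ico_right_eq_Ico_add_one ht, Finset.filter_insert]
  split_ifs with h
  · rw [Finset.card_insert_of_notMem (by simp)]
  · simp

lemma successes_succ (a : ℕ → Fin 2) (r : ℕ → Bool) (b : Fin 2) (ht : 1 ≤ t) :
    successes a r b (t + 1) = successes a r b t + if a t = b ∧ r t = true then 1 else 0 := by
  unfold successes
  rw [← Finset.insert_Ico_right_eq_Ico_add_one ht, Finset.filter_insert]
  split_ifs with h
  · rw [Finset.card_insert_of_notMem (by simp)]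
  · simp

lemma visits_mono (a : ℕ → Fin 2) (b : Fin 2) : Monotone (visits a b) := fun _ _ hst =>
  Finset.card_le_card (Finset.filter_subset_filter _ (Finset.Ico_subset_Ico le_rfl hst))

lemma successes_le_visits (a : ℕ → Fin 2) (r : ℕ → Bool) (b : Fin 2) (t : ℕ) :
    successes a r b t ≤ visits a b t :=
  Finset.card_le_card (Finset.monotone_filter_right _ fun _ _ h => h.1)

lemma visits_add_visits (a : ℕ → Fin 2) {b b' : Fin 2} (hb : b ≠ b') (t : ℕ) :
    visits a b t + visits a b' t = t - 1 := by
  have h := Finset.card_filter_add_card_filter_not (s := Finset.Ico 1 t) (fun i => a i = b)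
  rw [Nat.card_Ico] at h
  rw [← h]
  unfold visits
  congr 2
  refine Finset.filter_congr fun i _ => ?_
  omega

lemma empMean_nonneg (a : ℕ → Fin 2) (r : ℕ → Bool) (b : Fin 2) (t : ℕ) : 0 ≤ empMean a r b t := by
  unfold empMean; positivity

lemma empMean_le_one (a : ℕ → Fin 2) (r : ℕ → Bool) (b : Fin 2) (t : ℕ) : empMean a r b t ≤ 1 :=
  div_le_one_of_le₀ (by exact_mod_cast successes_le_visits a r b t) (by positivity)

lemma ucbIndex_of_visits_ne_zero (h : visits a b t ≠ 0) :
    ucbIndex a r b t = ((empMean a r b t + bonus a b t : ℝ) : EReal) := by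
  rw [ucbIndex, if_neg h, bonus]

lemma FollowsUCB.index_le (h : FollowsUCB a r) (ht : 1 ≤ t) (b : Fin 2)
    (h0 : visits a b t ≠ 0) (h1 : visits a (a t) t ≠ 0) :
    empMean a r b t + bonus a b t ≤ empMean a r (a t) t + bonus a (a t) t := by
  have := h t ht b
  rwa [ucbIndex_of_visits_ne_zero h0, ucbIndex_of_visits_ne_zero h1, EReal.coe_le_coe_iff] at this

lemma FollowsUCB.action_eq_one (h : FollowsUCB a r) (ht : 1 ≤ t)
    (h0 : visits a 0 t ≠ 0) (h1 : visits a 1 t ≠ 0)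
    (hlt : empMean a r 0 t + bonus a 0 t < empMean a r 1 t + bonus a 1 t) : a t = 1 := by
  by_contra hne
  have hz : a t = 0 := by omega
  have := h.index_le ht 1 h1 (by rwa [hz])
  rw [hz] at this
  linarith

/-! ### Good starts and the evolution of the indices after them -/

/-- A criterion under which a run of successes of arm `1` from time `t` on forces UCB to keep pulling
this arm, over a horizon of at most `Q` rounds. -/
structure GoodStart (c : ℝ) (Q : ℕ) (a : ℕ → Fin 2) (r : ℕ → Bool) (t : ℕ) : Prop where
  visits_zero_ne : visits a 0 t ≠ 0
  visits_one_ne : visits a 1 t ≠ 0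
  sq_le_visits : (Q : ℝ) ^ 2 ≤ c * visits a 1 t
  horizon_le : Q ≤ t
  horizon_le_log : 4 * (Q : ℝ) ≤ c * Real.sqrt (Real.log t)
  bonus_le_one : bonus a 1 t ≤ 1
  slack : 3 * c ≤ 1 - empMean a r 1 t - bonus a 1 t / 2

lemma GoodStart.congr {c : ℝ} {Q : ℕ} (h : GoodStart c Q a r t)
    (ha : ∀ i, 1 ≤ i → i < t → a i = a' i) (hr : ∀ i, 1 ≤ i → i < t → r i = r' i) :
    GoodStart c Q a' r' t := by
  have hv : ∀ b, visits a b t = visits a' b t := fun b => visits_congr ha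
  have hs : ∀ b, successes a r b t = successes a' r' b t := fun b => successes_congr ha hr
  obtain ⟨h1, h2, h3, h4, h5, h6, h7⟩ := h
  simp only [empMean, bonus, hv, hs] at h1 h2 h3 h6 h7
  exact ⟨h1, h2, h3, h4, h5, by simpa only [bonus] using h6,
    by simpa only [empMean, bonus] using h7⟩

lemma visits_add_of_eq_one (ht : 1 ≤ t) {q : ℕ} (h : ∀ i, t ≤ i → i < t + q → a i = 1) :
    visits a 1 (t + q) = visits a 1 t + q ∧ visits a 0 (t + q) = visits a 0 t := by
  induction q with
  | zero => simp
  | succ q ih =>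
    obtain ⟨ih1, ih2⟩ := ih fun i hi hi' => h i hi (by omega)
    have h1 : a (t + q) = 1 := h _ (by omega) (by omega)
    rw [← add_assoc, visits_succ a 1 (by omega), visits_succ a 0 (by omega), ih1, ih2]
    simp [h1, add_assoc]

lemma successes_zero_add_of_eq_one (ht : 1 ≤ t) {q : ℕ} (h : ∀ i, t ≤ i → i < t + q → a i = 1) :
    successes a r 0 (t + q) = successes a r 0 t := by
  induction q with
  | zero => simp
  | succ q ih =>
    have h1 : a (t + q) = 1 := h _ (by omega) (by omega)
    rw [← add_assoc, successes_succ a r 0 (by omega), ih fun i hi hi' => h i hi (by omega)]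
    simp [h1]

lemma le_successes_one_add (ht : 1 ≤ t) {m q : ℕ} (hmq : m ≤ q)
    (h : ∀ i, t ≤ i → i < t + q → a i = 1) (hr : ∀ i, t ≤ i → i < t + m → r i = true) :
    successes a r 1 t + m ≤ successes a r 1 (t + q) := by
  induction q with
  | zero => simp_all
  | succ q ih =>
    rw [← add_assoc, successes_succ a r 1 (by omega)]
    have h' : ∀ i, t ≤ i → i < t + q → a i = 1 := fun i hi hi' => h i hi (by omega)
    rcases Nat.lt_or_ge q m with hm | hm
    · obtain rfl : m = q + 1 := by omega
      have key : ∀ p ≤ q, successes a r 1 t + p ≤ successes a r 1 (t + p) := by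
        intro p hp
        induction p with
        | zero => simp
        | succ p ihp =>
          rw [← add_assoc, ← add_assoc, successes_succ a r 1 (by omega),
            if_pos ⟨h' _ (by omega) (by omega), hr _ (by omega) (by omega)⟩]
          exact Nat.add_le_add_right (ihp (by omega)) 1
      rw [if_pos ⟨h _ (by omega) (by omega), hr _ (by omega) (by omega)⟩]
      have := key q le_rfl
      omega
    · have := ih hm h'
      omega

/-- Over the `q` rounds after `t` the index of an arm that is not pulled grows very little. -/
lemma sqrt_log_add_sub_le {t q : ℕ} {N : ℝ} (ht : 2 ≤ t) (hN : 1 ≤ N) :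
    Real.sqrt (2 * Real.log ((t + q : ℕ) : ℝ) / N) - Real.sqrt (2 * Real.log (t : ℝ) / N) ≤
      (q : ℝ) / t / Real.sqrt (Real.log t) := by
  have ht' : (2 : ℝ) ≤ t := by exact_mod_cast ht
  have hlog : 0 < Real.log t := Real.log_pos (by linarith)
  have hq : (0 : ℝ) ≤ q / t := by positivity
  have hle : Real.log ((t + q : ℕ) : ℝ) ≤ Real.log t + q / t := by
    have h1 : (((t + q : ℕ) : ℝ)) = t * (1 + q / t) := by push_cast; field_simp
    rw [h1, Real.log_mul (by positivity) (by positivity)]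
    have := Real.log_le_sub_one_of_pos (x := 1 + (q : ℝ) / t) (by positivity)
    linarith
  set L := Real.log (t : ℝ)
  set y := (q : ℝ) / t
  have hs : 0 < Real.sqrt L := Real.sqrt_pos.2 hlog
  have hs2 : Real.sqrt L ^ 2 = L := Real.sq_sqrt hlog.le
  have h1 : Real.sqrt (2 * Real.log ((t + q : ℕ) : ℝ) / N) ≤
      Real.sqrt (2 / N) * (Real.sqrt L + y / Real.sqrt L / 2) := by
    rw [show 2 * Real.log ((t + q : ℕ) : ℝ) / N = 2 / N * Real.log ((t + q : ℕ) : ℝ) by ring,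
      Real.sqrt_mul (by positivity)]
    -- Tangent line of the square root at `L`. The factor `1 / √L` is what makes the drift `o(1/t)`.
    refine mul_le_mul_of_nonneg_left ?_ (Real.sqrt_nonneg _)
    refine Real.sqrt_le_iff.2 ⟨by positivity, hle.trans ?_⟩
    have : (Real.sqrt L + y / Real.sqrt L / 2) ^ 2 = L + y + (y / Real.sqrt L / 2) ^ 2 := by
      rw [add_sq, hs2]; field_simp
    rw [this]
    nlinarith [sq_nonneg (y / Real.sqrt L / 2)]
  have h2 : Real.sqrt (2 * L / N) = Real.sqrt (2 / N) * Real.sqrt L := by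
    rw [← Real.sqrt_mul (by positivity)]; congr 1; ring
  have h3 : Real.sqrt (2 / N) ≤ 2 := by
    refine Real.sqrt_le_iff.2 ⟨by norm_num, ?_⟩
    rw [div_le_iff₀ (by linarith)]; linarith
  have h4 : 0 ≤ y / Real.sqrt L := by positivity
  rw [h2]
  nlinarith

/-- This is `(1 + y)^(-1/2) ≥ 1 - y/2` with `y = q / n`, the loss of bonus due to `q` more pulls.
For `y > 2` the left side is negative. -/
lemma one_sub_half_mul_sqrt_le {x n q : ℝ} (hx : 0 ≤ x) (hn : 0 < n) (hq : 0 ≤ q) :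
    Real.sqrt (x / n) * (1 - q / n / 2) ≤ Real.sqrt (x / (n + q)) := by
  rcases le_or_gt (q / n) 2 with hy | hy
  · refine Real.le_sqrt_of_sq_le ?_
    have hy0 : 0 ≤ q / n := by positivity
    have h1 : x / (n + q) = x / n / (1 + q / n) := by field_simp
    rw [mul_pow, Real.sq_sqrt (by positivity), h1, div_eq_mul_inv (x / n), ← one_div]
    refine mul_le_mul_of_nonneg_left ?_ (by positivity)
    rw [le_div_iff₀ (by positivity)]
    nlinarith [mul_nonneg (sq_nonneg (q / n)) (sub_nonneg.2 hy)]
  · refine (mul_nonpos_of_nonneg_of_nonpos (Real.sqrt_nonneg _) ?_).trans (Real.sqrt_nonneg _)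
    linarith

/-- At a good start, if arm `1` is pulled in the rounds `t, …, t + q - 1` and the first `m` of these
pulls are successes, `m` being large compared with `q - m`, then UCB pulls arm `1` again. -/
lemma GoodStart.action_eq_one {c : ℝ} {Q m q : ℕ} (hc : 0 < c) (hg : GoodStart c Q a r t)
    (hf : FollowsUCB a r) (hmq : m ≤ q) (hq0 : 0 < q) (hqQ : q ≤ Q)
    (ha : ∀ i, t ≤ i → i < t + q → a i = 1) (hr : ∀ i, t ≤ i → i < t + m → r i = true)
    (hm : 2 * c ≤ 3 * c * m - 3 / 2 * ((q : ℝ) - m)) : a (t + q) = 1 := by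
  obtain ⟨hv0, hv1, hsq, hQt, hlog, hb1, hslack⟩ := hg
  have hn0 : (1 : ℝ) ≤ visits a 0 t := by exact_mod_cast Nat.one_le_iff_ne_zero.2 hv0
  have hn1 : (1 : ℝ) ≤ visits a 1 t := by exact_mod_cast Nat.one_le_iff_ne_zero.2 hv1
  have hsum := visits_add_visits a (b := 0) (b' := 1) (by decide) t
  have ht2 : 2 ≤ t := by omega
  have ht1 : 1 ≤ t := by omega
  obtain ⟨hV1, hV0⟩ := visits_add_of_eq_one ht1 ha
  have hS0 := successes_zero_add_of_eq_one (r := r) ht1 ha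
  have hS1 := le_successes_one_add ht1 hmq ha hr
  have hat : a t = 1 := ha t le_rfl (by omega)
  -- Arm `1` is pulled at time `t`, so it does not trail there. It remains to see that its lead
  -- grows strictly.
  have hidx := hf.index_le ht1 0 hv0 (by rwa [hat])
  rw [hat] at hidx
  refine hf.action_eq_one (by omega) (by rwa [hV0]) (by omega) ?_
  have hlogt : 0 ≤ Real.log (t : ℝ) := Real.log_natCast_nonneg t
  have herr := sqrt_log_add_sub_le (q := q) ht2 hn0
  set n : ℝ := (visits a 1 t : ℝ) with hn
  have hqr : (0 : ℝ) ≤ q := Nat.cast_nonneg q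
  have hmr : (0 : ℝ) ≤ m := Nat.cast_nonneg m
  have hmq' : (m : ℝ) ≤ q := by exact_mod_cast hmq
  have hqQ' : (q : ℝ) ≤ Q := by exact_mod_cast hqQ
  have hnt : n + q ≤ 2 * t := by
    have : visits a 1 t + q ≤ 2 * t := by omega
    rw [hn]; exact_mod_cast this
  have ht' : (2 : ℝ) ≤ t := by exact_mod_cast ht2
  have hL : 0 < Real.sqrt (Real.log t) := Real.sqrt_pos.2 (Real.log_pos (by linarith))
  have hI0 : empMean a r 0 (t + q) + bonus a 0 (t + q) ≤
      empMean a r 0 t + bonus a 0 t + (q : ℝ) / t / Real.sqrt (Real.log t) := by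
    unfold empMean bonus
    rw [hS0, hV0]
    linarith
  have hV1' : (visits a 1 (t + q) : ℝ) = n + q := by rw [hV1, Nat.cast_add]
  have hnq : 0 < n + q := by linarith
  have hb : bonus a 1 t * (1 - q / n / 2) ≤ bonus a 1 (t + q) := by
    unfold bonus
    rw [hV1', ← hn]
    refine (one_sub_half_mul_sqrt_le (by positivity) (by linarith) hqr).trans ?_
    refine Real.sqrt_le_sqrt (div_le_div_of_nonneg_right ?_ hnq.le)
    have : Real.log (t : ℝ) ≤ Real.log ((t + q : ℕ) : ℝ) :=
      Real.log_le_log (by linarith) (by push_cast; linarith)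
    linarith
  have hmean : empMean a r 1 t + (m - empMean a r 1 t * q) / (n + q) ≤ empMean a r 1 (t + q) := by
    have hS1' : (successes a r 1 t : ℝ) + m ≤ successes a r 1 (t + q) := by exact_mod_cast hS1
    unfold empMean
    rw [hV1', ← hn]
    have : (successes a r 1 t : ℝ) / n + (m - (successes a r 1 t : ℝ) / n * q) / (n + q) =
        ((successes a r 1 t : ℝ) + m) / (n + q) := by
      field_simp
      ring
    rw [this]
    gcongr
  have hμ0 := empMean_nonneg a r 1 t
  have hμ1 := empMean_le_one a r 1 t
  have hβ0 := bonus_nonneg a 1 t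
  set p := empMean a r 1 t
  set β := bonus a 1 t
  -- All changes of the indices are compared after multiplication by `n + q`. The two error terms,
  -- the drift of arm `0` and the second-order part of the bonus, cost at most `c / 2` each, against
  -- a gain of `2 * c`.
  have herr2 : (n + q) * ((q : ℝ) / t / Real.sqrt (Real.log t)) ≤ c / 2 := by
    calc (n + q) * ((q : ℝ) / t / Real.sqrt (Real.log t))
        ≤ (2 * t) * ((Q : ℝ) / t / Real.sqrt (Real.log t)) := by gcongr
      _ = 2 * Q / Real.sqrt (Real.log t) := by field_simp
      _ ≤ c / 2 := by rw [div_le_iff₀ hL]; linarith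
  have hβerr : (n + q) * (β * (q / n / 2)) ≤ β * q / 2 + c / 2 := by
    have h1 : (n + q) * (β * (q / n / 2)) = β * q / 2 + β * (q ^ 2 / n) / 2 := by
      field_simp
    have h2 : (q : ℝ) ^ 2 / n ≤ c := by
      rw [div_le_iff₀ (by linarith)]
      exact le_trans (by gcongr) hsq
    have h3 : β * (q ^ 2 / n) ≤ 1 * c := by gcongr
    rw [h1]; linarith
  -- Each of the `m` successes contributes at least `3 * c` by the slack. Each of the other `q - m`
  -- pulls costs at most `3 / 2`, as `p` and `β` are at most one.
  have hgain : 2 * c ≤ m - p * q - β * q / 2 := by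
    have h1 : (m : ℝ) - p * q - β * q / 2 = m * (1 - p - β / 2) - (q - m) * (p + β / 2) := by ring
    have h2 : (m : ℝ) * (3 * c) ≤ m * (1 - p - β / 2) := by gcongr
    have h3 : ((q : ℝ) - m) * (p + β / 2) ≤ (q - m) * (3 / 2) := by
      refine mul_le_mul_of_nonneg_left (by linarith) (by linarith)
    rw [h1]; linarith
  have hpos : 0 < (m - p * q) / (n + q) - β * (q / n / 2) -
      (q : ℝ) / t / Real.sqrt (Real.log t) := by
    refine pos_of_mul_pos_right (a := n + q) ?_ hnq.le
    rw [mul_sub, mul_sub, mul_div_cancel₀ _ hnq.ne']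
    linarith
  nlinarith


/-! ### Recurrence of good starts -/

/-- UCB pulls every arm infinitely often. -/
lemma FollowsUCB.tendsto_visits (hf : FollowsUCB a r) (b : Fin 2) :
    Tendsto (visits a b) atTop atTop := by
  refine tendsto_atTop_atTop_of_monotone (visits_mono a b) ?_
  by_contra! hK
  obtain ⟨K, hK⟩ := hK
  -- The constant is `9 = 3 ^ 2`: the bonus of an arm with at most `K` pulls exceeds `3`, while the
  -- other arm has mean at most `1` and, holding about half of the rounds or more, bonus at most
  -- `2`.
  have hlog : ∀ᶠ t : ℕ in atTop, 9 * (K : ℝ) < 2 * Real.log t :=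
    ((Real.tendsto_log_atTop.comp tendsto_natCast_atTop_atTop).const_mul_atTop
      (by norm_num : (0 : ℝ) < 2)).eventually_gt_atTop _
  have hK0 : 0 < K := (Nat.zero_le _).trans_lt (hK 0)
  have hev : ∀ᶠ t : ℕ in atTop, a t = b := by
    filter_upwards [hlog, eventually_ge_atTop (2 * K + 2)] with t ht ht2
    by_contra hne
    have hsum := visits_add_visits a (b := b) (b' := a t) (Ne.symm hne) t
    have hKt := hK t
    have hv' : visits a (a t) t ≠ 0 := by omega
    have hv : visits a b t ≠ 0 := by
      intro h0
      have := hf t (by omega) b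
      rw [ucbIndex_of_visits_ne_zero hv', ucbIndex, if_pos h0] at this
      exact EReal.coe_ne_top _ (top_le_iff.1 this)
    have hidx := hf.index_le (by omega) b hv hv'
    have h1 := empMean_nonneg a r b t
    have h2 := empMean_le_one a r (a t) t
    have h3 : bonus a (a t) t ≤ 2 := by
      refine Real.sqrt_le_iff.2 ⟨by norm_num, ?_⟩
      have h4 : (t : ℝ) - 1 ≤ 2 * visits a (a t) t := by
        have : t ≤ 2 * visits a (a t) t + 1 := by omega
        have : (t : ℝ) ≤ 2 * visits a (a t) t + 1 := by exact_mod_cast this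
        linarith
      have h5 : Real.log t ≤ t - 1 :=
        Real.log_le_sub_one_of_pos (by exact_mod_cast (by omega : 0 < t))
      rw [div_le_iff₀ (by exact_mod_cast Nat.pos_of_ne_zero hv')]
      linarith
    have h4 : 3 < bonus a b t := by
      refine Real.lt_sqrt_of_sq_lt ?_
      have hvK : (visits a b t : ℝ) ≤ K := by exact_mod_cast hKt.le
      rw [lt_div_iff₀ (by exact_mod_cast Nat.pos_of_ne_zero hv)]
      linarith
    linarith
  obtain ⟨t₀, ht₀⟩ := eventually_atTop.1 hev
  have key : ∀ q, q ≤ visits a b (t₀ + 1 + q) := by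
    intro q
    induction q with
    | zero => exact Nat.zero_le _
    | succ q ih =>
      rw [← add_assoc, visits_succ a b (by omega), if_pos (ht₀ _ (by omega))]
      omega
  exact absurd (key K) (hK _).not_ge

lemma frequently_eq_of_tendsto_visits (h : Tendsto (visits a b) atTop atTop) :
    ∃ᶠ t in atTop, a t = b := by
  intro hev
  obtain ⟨t₀, ht₀⟩ := eventually_atTop.1 hev
  have key : ∀ q, visits a b (t₀ + 1 + q) = visits a b (t₀ + 1) := by
    intro q
    induction q with
    | zero => rfl
    | succ q ih =>
      rw [← add_assoc, visits_succ a b (by omega), if_neg (ht₀ _ (by omega)), ih, add_zero]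
  obtain ⟨t, ht, ht'⟩ := ((h.eventually_gt_atTop (visits a b (t₀ + 1))).and
    (eventually_ge_atTop (t₀ + 1))).exists
  obtain ⟨q, rfl⟩ := Nat.exists_eq_add_of_le ht'
  exact ht.ne' (key q)

lemma frequently_switch (h0 : ∃ᶠ t in atTop, a t = 0) (h1 : ∃ᶠ t in atTop, a t = 1) :
    ∃ᶠ t in atTop, a t = 0 ∧ a (t + 1) = 1 := by
  rw [frequently_atTop] at h0 h1 ⊢
  intro t₀
  obtain ⟨s, hs, hs0⟩ := h0 t₀
  by_contra! hcon
  have key : ∀ q, a (s + q) = 0 := by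
    intro q
    induction q with
    | zero => exact hs0
    | succ q ih =>
      have := hcon (s + q) (by omega) ih
      rw [← add_assoc]
      omega
  obtain ⟨u, hu, hu1⟩ := h1 s
  obtain ⟨q, rfl⟩ := Nat.exists_eq_add_of_le hu
  rw [key q] at hu1
  exact absurd hu1 (by decide)

lemma tendsto_sqrt_log_div : Tendsto (fun t : ℕ => Real.sqrt (4 * Real.log t / (t - 1)))
    atTop (𝓝 0) := by
  have h1 : Tendsto (fun x : ℝ => Real.log x / (x - 1)) atTop (𝓝 0) := by
    have := Real.tendsto_pow_log_div_mul_add_atTop 1 (-1) 1 one_ne_zero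
    simpa [sub_eq_add_neg] using this
  have h2 := ((h1.comp tendsto_natCast_atTop_atTop).const_mul 4).sqrt
  simpa [Function.comp_def, mul_div_assoc] using h2

lemma sqrt_add_le_sqrt_add_sqrt {x y : ℝ} (hx : 0 ≤ x) (hy : 0 ≤ y) :
    Real.sqrt (x + y) ≤ Real.sqrt x + Real.sqrt y := by
  refine Real.sqrt_le_iff.2 ⟨by positivity, ?_⟩
  have := mul_nonneg (Real.sqrt_nonneg x) (Real.sqrt_nonneg y)
  rw [add_sq, Real.sq_sqrt hx, Real.sq_sqrt hy]
  linarith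

/-- Transfers the bound on the bonus of arm `1`, known in the round where arm `0` is preferred, to
the following round. -/
lemma bonus_succ_le (h : visits a b (t + 1) = visits a b t) (hv : visits a b t ≠ 0) (ht : 1 ≤ t) :
    bonus a b (t + 1) ≤ bonus a b t + Real.sqrt (2 / t) := by
  have ht' : (1 : ℝ) ≤ t := by exact_mod_cast ht
  have hv' : (1 : ℝ) ≤ visits a b t := by exact_mod_cast Nat.one_le_iff_ne_zero.2 hv
  have hlog : Real.log ((t + 1 : ℕ) : ℝ) ≤ Real.log t + 1 / t := by
    have h1 : (((t + 1 : ℕ) : ℝ)) = t * (1 + 1 / t) := by push_cast; field_simp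
    rw [h1, Real.log_mul (by positivity) (by positivity)]
    have := Real.log_le_sub_one_of_pos (x := 1 + 1 / (t : ℝ)) (by positivity)
    linarith
  have hl : 0 ≤ Real.log (t : ℝ) := Real.log_natCast_nonneg t
  unfold bonus
  rw [h]
  refine le_trans (Real.sqrt_le_sqrt ?_)
    (sqrt_add_le_sqrt_add_sqrt (x := 2 * Real.log t / visits a b t) (y := 2 / t) ?_ ?_)
  · have h2 : (2 : ℝ) / t / visits a b t ≤ 2 / t := div_le_self (by positivity) hv'
    refine le_trans (div_le_div_of_nonneg_right (mul_le_mul_of_nonneg_left hlog (by norm_num))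
      (by positivity)) ?_
    rw [mul_add, add_div]
    refine add_le_add_right (le_of_eq_of_le ?_ h2) _
    ring
  all_goals positivity

/-- If the empirical means converge to the true ones, good starts occur again and again: they are
the times at which UCB switches from arm `0` to arm `1`. -/
lemma FollowsUCB.frequently_goodStart {μ : Fin 2 → ℝ} {c : ℝ} (hf : FollowsUCB a r)
    (hlim : ∀ b, Tendsto (empMean a r b) atTop (𝓝 (μ b))) (hμ : μ 1 < μ 0) (hμ' : μ 0 - μ 1 < 1)
    (hc : 0 < c) (hc' : 3 * c < 1 - μ 1 - (μ 0 - μ 1) / 2) (Q : ℕ) :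
    ∃ᶠ t in atTop, GoodStart c Q a r t ∧ a t = 1 := by
  -- `2 * ε` keeps the empirical means separated, `4 * ε` keeps the bonus of arm `1` below one, and
  -- `3 * ε` fits into the slack.
  obtain ⟨ε, hε, h2ε, h4ε, h3ε⟩ : ∃ ε : ℝ, 0 < ε ∧ 2 * ε < μ 0 - μ 1 ∧ 4 * ε ≤ 1 - (μ 0 - μ 1) ∧
      3 * ε ≤ 1 - μ 1 - (μ 0 - μ 1) / 2 - 3 * c := by
    refine ⟨min ((μ 0 - μ 1) / 3) (min ((1 - (μ 0 - μ 1)) / 4)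
      ((1 - μ 1 - (μ 0 - μ 1) / 2 - 3 * c) / 3)), ?_, ?_, ?_, ?_⟩
    · refine lt_min (by linarith) (lt_min (by linarith) (by linarith))
    · have := min_le_left ((μ 0 - μ 1) / 3) (min ((1 - (μ 0 - μ 1)) / 4)
        ((1 - μ 1 - (μ 0 - μ 1) / 2 - 3 * c) / 3))
      linarith
    · have := (min_le_right ((μ 0 - μ 1) / 3) (min ((1 - (μ 0 - μ 1)) / 4)
        ((1 - μ 1 - (μ 0 - μ 1) / 2 - 3 * c) / 3))).trans (min_le_left _ _)
      linarith
    · have := (min_le_right ((μ 0 - μ 1) / 3) (min ((1 - (μ 0 - μ 1)) / 4)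
        ((1 - μ 1 - (μ 0 - μ 1) / 2 - 3 * c) / 3))).trans (min_le_right _ _)
      linarith
  have hmean : ∀ᶠ t in atTop, ∀ b, |empMean a r b t - μ b| < ε := by
    rw [eventually_all]
    intro b
    simpa [Real.dist_eq] using (Metric.tendsto_nhds.1 (hlim b)) ε hε
  have hbonus := tendsto_sqrt_log_div.eventually_lt_const hε
  have hinc : ∀ᶠ t : ℕ in atTop, Real.sqrt (2 / t) < ε := by
    have : Tendsto (fun t : ℕ => Real.sqrt (2 / t)) atTop (𝓝 0) := by
      simpa using (tendsto_const_div_atTop_nhds_zero_nat (2 : ℝ)).sqrt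
    exact this.eventually_lt_const hε
  have hvis : ∀ᶠ t in atTop, ∀ b, visits a b t ≠ 0 := by
    rw [eventually_all]
    exact fun b => (hf.tendsto_visits b).eventually_ne_atTop 0
  have hsq : ∀ᶠ t in atTop, (Q : ℝ) ^ 2 ≤ c * visits a 1 t :=
    ((tendsto_natCast_atTop_atTop.comp (hf.tendsto_visits 1)).const_mul_atTop
      hc).eventually_ge_atTop _
  have hlog : ∀ᶠ t : ℕ in atTop, 4 * (Q : ℝ) ≤ c * Real.sqrt (Real.log t) :=
    ((Real.tendsto_sqrt_atTop.comp (Real.tendsto_log_atTop.comp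
      tendsto_natCast_atTop_atTop)).const_mul_atTop hc).eventually_ge_atTop _
  have hsw := frequently_switch (frequently_eq_of_tendsto_visits (hf.tendsto_visits 0))
    (frequently_eq_of_tendsto_visits (hf.tendsto_visits 1))
  have hshift : Tendsto (fun t : ℕ => t + 1) atTop atTop := tendsto_add_atTop_nat 1
  refine hshift.frequently ?_
  refine (hsw.and_eventually (hmean.and (hbonus.and (hinc.and (hvis.and
    (hshift.eventually (hmean.and (hvis.and (hsq.and
      (hlog.and (eventually_ge_atTop (Q + 2)))))))))))).mono ?_
  rintro t ⟨⟨ha0, ha1⟩, hmean, hbonus, hinc, hvis, hmean', hvis', hsq, hlog, hQ⟩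
  refine ⟨?_, ha1⟩
  have ht1 : 1 ≤ t := by omega
  have hidx := hf.index_le ht1 1 (hvis 1) (hvis _)
  have hidx' := hf.index_le (t := t + 1) (by omega) 0 (hvis' 0) (hvis' _)
  rw [ha0] at hidx
  rw [ha1] at hidx'
  have hv1 : visits a 1 (t + 1) = visits a 1 t := by simp [visits_succ a 1 ht1, ha0]
  have hv0 : visits a 0 (t + 1) = visits a 0 t + 1 := by simp [visits_succ a 0 ht1, ha0]
  have hm0 := abs_lt.1 (hmean 0)
  have hm1 := abs_lt.1 (hmean 1)
  have hm0' := abs_lt.1 (hmean' 0)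
  have hm1' := abs_lt.1 (hmean' 1)
  -- Arm `1` has the smaller empirical mean, so it can be chosen only through a larger bonus, that
  -- is, fewer pulls.
  have hle : visits a 1 (t + 1) < visits a 0 (t + 1) := by
    by_contra! hge
    have hge' : (visits a 0 (t + 1) : ℝ) ≤ visits a 1 (t + 1) := by exact_mod_cast hge
    have hpos : (0 : ℝ) < visits a 0 (t + 1) := by
      exact_mod_cast Nat.pos_of_ne_zero (hvis' 0)
    have hl : 0 ≤ Real.log ((t + 1 : ℕ) : ℝ) := Real.log_natCast_nonneg _
    have : bonus a 1 (t + 1) ≤ bonus a 0 (t + 1) :=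
      Real.sqrt_le_sqrt (div_le_div_of_nonneg_left (by positivity) hpos hge')
    linarith
  -- Arm `0` thus holds at least half of the first `t - 1` pulls.
  have hb0 : bonus a 0 t < ε := by
    refine lt_of_le_of_lt (Real.sqrt_le_sqrt ?_) hbonus
    have hsum := visits_add_visits a (b := 0) (b' := 1) (by decide) t
    have h1 : t ≤ 2 * visits a 0 t + 1 := by omega
    have h1' : (t : ℝ) - 1 ≤ 2 * visits a 0 t := by
      have : (t : ℝ) ≤ 2 * visits a 0 t + 1 := by exact_mod_cast h1
      linarith
    have hl : 0 ≤ Real.log (t : ℝ) := Real.log_natCast_nonneg t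
    have hpos : (0 : ℝ) < visits a 0 t := by exact_mod_cast Nat.pos_of_ne_zero (hvis 0)
    have ht2 : (2 : ℝ) ≤ t := by
      have := hvis 0
      have := hvis 1
      exact_mod_cast (by omega : 2 ≤ t)
    rw [div_le_div_iff₀ hpos (by linarith)]
    nlinarith
  -- Preferring arm `0` at `t` bounds the bonus of arm `1` by `μ 0 - μ 1 + 3 * ε`; the passage to `t
  -- + 1` costs another `ε`.
  have hb1 := bonus_succ_le (b := 1) hv1 (hvis 1) ht1
  exact ⟨hvis' 0, hvis' 1, hsq, by omega, hlog, by linarith, by linarith⟩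

/-! ### Winning runs and certified times -/

/-- After a good start, `m` consecutive pulls of arm `1` with reward one took place in the rounds
`t - m, …, t - 1`, and arm `1` is chosen again in round `t`. -/
def WinningRun (c : ℝ) (Q m : ℕ) (a : ℕ → Fin 2) (r : ℕ → Bool) (t : ℕ) : Prop :=
  ∃ u, 1 ≤ u ∧ u + m = t ∧ GoodStart c Q a r u ∧ (∀ i, u ≤ i → i ≤ t → a i = 1) ∧
    ∀ i, u ≤ i → i < t → r i = true

/-- The action of round `t` enters but its reward does not, so the event is known before `R t` is
drawn. -/
lemma WinningRun.congr {c : ℝ} {Q m : ℕ} (h : WinningRun c Q m a r t)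
    (ha : ∀ i, 1 ≤ i → i ≤ t → a i = a' i) (hr : ∀ i, 1 ≤ i → i < t → r i = r' i) :
    WinningRun c Q m a' r' t := by
  obtain ⟨u, hu, hut, hg, h1, h2⟩ := h
  refine ⟨u, hu, hut, hg.congr (fun i hi hi' => ha i hi (by omega))
    (fun i hi hi' => hr i hi (by omega)), fun i hi hi' => ?_, fun i hi hi' => ?_⟩
  · rw [← ha i (by omega) hi', h1 i hi hi']
  · rw [← hr i (by omega) hi', h2 i hi hi']

lemma WinningRun.action_eq_one {c : ℝ} {Q m : ℕ} (h : WinningRun c Q m a r t) : a t = 1 := by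
  obtain ⟨u, hu, hut, -, h1, -⟩ := h
  exact h1 t (by omega) le_rfl

lemma WinningRun.succ {c : ℝ} {Q m : ℕ} (hc : 0 < c) (hf : FollowsUCB a r) (hmQ : m < Q)
    (h : WinningRun c Q m a r t) (hrt : r t = true) : WinningRun c Q (m + 1) a r (t + 1) := by
  obtain ⟨u, hu, rfl, hg, h1, h2⟩ := h
  have h2' : ∀ i, u ≤ i → i < u + (m + 1) → r i = true := fun i hi hi' => by
    rcases eq_or_ne i (u + m) with rfl | hne
    · exact hrt
    · exact h2 i hi (by omega)
  have hnext : a (u + (m + 1)) = 1 :=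
    hg.action_eq_one hc hf le_rfl (Nat.succ_pos m) hmQ (fun i hi hi' => h1 i hi (by omega)) h2'
      (by push_cast; nlinarith [Nat.cast_nonneg (α := ℝ) m])
  refine ⟨u, hu, rfl, hg, fun i hi hi' => ?_, h2'⟩
  rcases eq_or_ne i (u + (m + 1)) with rfl | hne
  · exact hnext
  · exact h1 i hi (by omega)

/-- Every trajectory of UCB that coincides with `(a, r)` before time `s` pulls arm `1` in all the
rounds `s, …, s + T - 1`. -/
def Certified (T : ℕ) (a : ℕ → Fin 2) (r : ℕ → Bool) (s : ℕ) : Prop :=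
  ∀ (a' : ℕ → Fin 2) (r' : ℕ → Bool), (∀ i, 1 ≤ i → i < s → a' i = a i ∧ r' i = r i) →
    FollowsUCB a' r' → ∀ i < T, a' (s + i) = 1

lemma Certified.congr {T s : ℕ} (h : Certified T a r s)
    (ha : ∀ i, 1 ≤ i → i < s → a i = a' i) (hr : ∀ i, 1 ≤ i → i < s → r i = r' i) :
    Certified T a' r' s := fun a₁ r₁ h₁ hf =>
  h a₁ r₁ (fun i hi hi' => by rw [ha i hi hi', hr i hi hi']; exact h₁ i hi hi') hf

lemma Certified.pseudoRegret_eq {T s : ℕ} (h : Certified T a r s) (μ : Fin 2 → ℝ)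
    (hf : FollowsUCB a' r') (h' : ∀ i, 1 ≤ i → i < s → a' i = a i ∧ r' i = r i) :
    pseudoRegret μ a' s T = (μ 0 - μ 1) * (T : ℝ) := by
  have hsum : ∑ i ∈ Finset.range T, μ (a' (s + i)) = ∑ i ∈ Finset.range T, μ 1 :=
    Finset.sum_congr rfl fun i hi => by rw [h a' r' h' hf i (Finset.mem_range.1 hi)]
  rw [pseudoRegret, hsum]
  simp
  ring

/-- A long enough winning run certifies that arm `1` is pulled in the next `T` rounds, whatever
their rewards. -/
lemma WinningRun.certified {c : ℝ} {M T : ℕ} (hc : 0 < c) (hM : 2 * c + 3 / 2 * T ≤ 3 * c * M)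
    (h : WinningRun c (M + T) M a r t) : Certified T a r t := by
  -- Ensures that round `u` lies before `t`, so that every competing trajectory also pulls arm `1`
  -- there, however ties are broken.
  have hM0 : 0 < M := by
    rcases Nat.eq_zero_or_pos M with rfl | h0
    · have : (0 : ℝ) ≤ T := Nat.cast_nonneg T
      simp at hM
      linarith
    · exact h0
  obtain ⟨u, hu, rfl, hg, h1, h2⟩ := h
  intro a' r' hagree hf
  have hg' : GoodStart c (M + T) a' r' u :=
    hg.congr (fun i hi hi' => (hagree i hi (by omega)).1.symm)
      (fun i hi hi' => (hagree i hi (by omega)).2.symm)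
  intro j
  induction j using Nat.strong_induction_on with
  | _ j ih =>
    intro hj
    rw [add_assoc]
    have hj' : (j : ℝ) ≤ T := by exact_mod_cast hj.le
    -- The `j` pulls after the run are counted as if they were all failures. The case `j = 0` covers
    -- round `t` itself, whose action in `a'` is not prescribed.
    refine hg'.action_eq_one hc hf (Nat.le_add_right M j) (by omega) (by omega)
      (fun i hi hi' => ?_) (fun i hi hi' => ?_) (by push_cast; linarith)
    · rcases Nat.lt_or_ge i (u + M) with hlt | hge
      · rw [(hagree i (by omega) hlt).1, h1 i hi hlt.le]
      · obtain ⟨q, rfl⟩ := Nat.exists_eq_add_of_le hge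
        exact ih q (by omega) (by omega)
    · rw [(hagree i (by omega) hi').2, h2 i hi hi']

end Trajectory

/-! ### Betting strategies and the law of large numbers -/

section Wealth

/-- The gain in round `i` of a gambler who bets on the reward of arm `b` whenever it is pulled, the
stake being the fraction `l` of the current wealth. -/
noncomputable def wager (μ : Fin 2 → ℝ) (l : ℝ) (b : Fin 2) (a : ℕ → Fin 2) (r : ℕ → Bool) (i : ℕ) :
    ℝ :=
  if a i = b then l * ((if r i = true then 1 else 0) - μ b) else 0

/-- The wealth of the gambler after `n` rounds, starting from wealth one. -/
noncomputable def wealth (μ : Fin 2 → ℝ) (l : ℝ) (b : Fin 2) (a : ℕ → Fin 2) (r : ℕ → Bool) (n : ℕ) :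
    ℝ :=
  ∏ i ∈ Finset.range n, (1 + wager μ l b a r (i + 1))

variable {μ : Fin 2 → ℝ} {l : ℝ} {b : Fin 2} {a : ℕ → Fin 2} {r : ℕ → Bool}

lemma abs_wager_le (hμ : μ b ∈ Set.Ioo (0 : ℝ) 1) (i : ℕ) : |wager μ l b a r i| ≤ |l| := by
  unfold wager
  split_ifs
  · rw [abs_mul]
    refine mul_le_of_le_one_right (abs_nonneg l) (abs_le.2 ⟨?_, ?_⟩) <;> linarith [hμ.1, hμ.2]
  · rw [abs_mul]
    refine mul_le_of_le_one_right (abs_nonneg l) (abs_le.2 ⟨?_, ?_⟩) <;> linarith [hμ.1, hμ.2]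
  · simp

lemma wealth_nonneg (hμ : μ b ∈ Set.Ioo (0 : ℝ) 1) (hl : |l| ≤ 1 / 2) (n : ℕ) :
    0 ≤ wealth μ l b a r n :=
  Finset.prod_nonneg fun i _ => by
    have := (abs_le.1 ((abs_wager_le (l := l) (a := a) (r := r) hμ (i + 1)).trans hl)).1
    linarith

lemma wealth_le_two_pow (hμ : μ b ∈ Set.Ioo (0 : ℝ) 1) (hl : |l| ≤ 1 / 2) (n : ℕ) :
    wealth μ l b a r n ≤ 2 ^ n := by
  have : ∏ i ∈ Finset.range n, (1 + wager μ l b a r (i + 1)) ≤ ∏ i ∈ Finset.range n, (2 : ℝ) := by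
    refine Finset.prod_le_prod (fun i _ => ?_) (fun i _ => ?_) <;>
    · have := abs_le.1 ((abs_wager_le (l := l) (a := a) (r := r) hμ (i + 1)).trans hl)
      linarith [this.1, this.2]
  simpa [wealth] using this

lemma exp_sub_two_mul_sq_le {x : ℝ} (hx : |x| ≤ 1 / 2) : Real.exp (x - 2 * x ^ 2) ≤ 1 + x := by
  obtain ⟨h1, h2⟩ := abs_le.1 hx
  have hpos : 0 < 1 + x := by linarith
  rw [← Real.le_log_iff_exp_le hpos]
  refine le_trans ?_ (Real.one_sub_inv_le_log_of_pos hpos)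
  have : 1 - (1 + x)⁻¹ = x / (1 + x) := by field_simp; ring
  rw [this, le_div_iff₀ hpos]
  nlinarith [mul_nonneg (sq_nonneg x) (by linarith : 0 ≤ 1 + 2 * x)]

/-- Multiplying `exp (x - 2 x²) ≤ 1 + x` over the rounds shows that a deviation of the successes
linear in the number of pulls makes a small-stake gambler exponentially rich. Betting only when `b`
is pulled avoids reindexing by the random pull times. -/
lemma exp_le_wealth (hμ : μ b ∈ Set.Ioo (0 : ℝ) 1) (hl : |l| ≤ 1 / 2) (n : ℕ) :
    Real.exp (l * (successes a r b (n + 1) - μ b * visits a b (n + 1)) -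
      2 * l ^ 2 * visits a b (n + 1)) ≤ wealth μ l b a r n := by
  induction n with
  | zero => simp [wealth, successes, visits]
  | succ n ih =>
    have hw := abs_wager_le (l := l) (a := a) (r := r) hμ (n + 1)
    have hstep : Real.exp (wager μ l b a r (n + 1) - if a (n + 1) = b then 2 * l ^ 2 else 0) ≤
        1 + wager μ l b a r (n + 1) := by
      split_ifs with h
      · refine le_trans (Real.exp_le_exp.2 ?_) (exp_sub_two_mul_sq_le (hw.trans hl))
        have := sq_le_sq.2 hw
        linarith
      · simp [wager, h]
    have hprod : wealth μ l b a r (n + 1) =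
        wealth μ l b a r n * (1 + wager μ l b a r (n + 1)) := Finset.prod_range_succ _ _
    rw [hprod]
    refine le_of_eq_of_le ?_ (mul_le_mul ih hstep (Real.exp_pos _).le (wealth_nonneg hμ hl n))
    rw [← Real.exp_add, visits_succ a b (by omega : 1 ≤ n + 1),
      successes_succ a r b (by omega : 1 ≤ n + 1)]
    congr 1
    unfold wager
    by_cases h : a (n + 1) = b <;> by_cases h' : r (n + 1) = true <;> simp [h, h'] <;> ring

/-- If no gambler gets arbitrarily rich, the empirical mean of an arm that is pulled infinitely
often converges to its true mean. -/
lemma tendsto_empMean_of_wealth_le (hμ : μ b ∈ Set.Ioo (0 : ℝ) 1)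
    (hv : Tendsto (visits a b) atTop atTop)
    (h : ∀ k : ℕ, (∃ C, ∀ n, wealth μ (1 / (k + 2)) b a r n ≤ C) ∧
      ∃ C, ∀ n, wealth μ (-(1 / (k + 2))) b a r n ≤ C) :
    Tendsto (empMean a r b) atTop (𝓝 (μ b)) := by
  rw [Metric.tendsto_nhds]
  intro ε hε
  obtain ⟨k, hk⟩ := exists_nat_gt (3 / ε)
  obtain ⟨⟨C₁, h₁⟩, C₂, h₂⟩ := h k
  set l : ℝ := 1 / (k + 2) with hl
  have hk0 : (0 : ℝ) ≤ k := Nat.cast_nonneg k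
  have hl0 : 0 < l := by positivity
  have hl2 : l ≤ 1 / 2 := by
    rw [hl]; exact one_div_le_one_div_of_le (by norm_num) (by linarith)
  have hlε : 3 * l < ε := by
    rw [div_lt_iff₀ hε] at hk
    rw [hl, mul_one_div, div_lt_iff₀ (by positivity)]
    nlinarith
  -- Stakes `l` and `-l` bound the deviation from both sides. Once `l ^ 2 * N` exceeds `log C` for
  -- both wealth bounds `C`, it is at most `3 * l * N`.
  have key : ∀ C l' : ℝ, |l'| = l → (∀ n, wealth μ l' b a r n ≤ C) →
      ∀ n, l' * (successes a r b (n + 1) - μ b * visits a b (n + 1)) -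
        2 * l ^ 2 * visits a b (n + 1) ≤ Real.log C := by
    intro C l' hl' hC n
    have := (exp_le_wealth (a := a) (r := r) hμ (hl'.trans_le hl2) n).trans (hC n)
    rw [← hl', sq_abs]
    exact (Real.le_log_iff_exp_le ((Real.exp_pos _).trans_le this)).2 this
  have hbig : ∀ C : ℝ, ∀ᶠ t in atTop, C < l ^ 2 * visits a b t := fun C =>
    ((tendsto_natCast_atTop_atTop.comp hv).const_mul_atTop (by positivity)).eventually_gt_atTop C
  filter_upwards [hbig (Real.log C₁), hbig (Real.log C₂), eventually_ge_atTop 1,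
    hv.eventually_gt_atTop 0] with t ht₁ ht₂ ht hpos
  obtain ⟨n, rfl⟩ := Nat.exists_eq_add_of_le' ht
  have k₁ := key C₁ l (abs_of_pos hl0) h₁ n
  have k₂ := key C₂ (-l) (by rw [abs_neg, abs_of_pos hl0]) h₂ n
  have hN : (0 : ℝ) < visits a b (n + 1) := by exact_mod_cast hpos
  rw [Real.dist_eq]
  refine lt_of_le_of_lt ?_ hlε
  have hdiv : empMean a r b (n + 1) - μ b =
      (successes a r b (n + 1) - μ b * visits a b (n + 1)) / visits a b (n + 1) := by
    unfold empMean; field_simp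
  rw [hdiv, abs_div, abs_of_pos hN, div_le_iff₀ hN]
  set N : ℝ := (visits a b (n + 1) : ℝ)
  set D : ℝ := successes a r b (n + 1) - μ b * N
  refine abs_le.2 ⟨?_, ?_⟩
  · have : l * (-D) ≤ l * (3 * l * N) := by linarith
    linarith [le_of_mul_le_mul_left this hl0]
  · exact le_of_mul_le_mul_left (by linarith : l * D ≤ l * (3 * l * N)) hl0

end Wealth

/-! ### Enumerating the occurrences of a property of times -/

section NthTime

open Classical in
/-- The time `s` is preceded by at least `k` occurrences of `p`, and is an occurrence itself. -/
def IsLateOccurrence (p : ℕ → Prop) (k s : ℕ) : Prop :=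
  1 ≤ s ∧ p s ∧ k ≤ ((Finset.Ico 1 s).filter p).card

open Classical in
/-- The `k`-th time (counted from zero) in `{1, 2, …}` at which `p` holds. -/
noncomputable def nthTime (p : ℕ → Prop) (k : ℕ) : WithTop ℕ :=
  if h : ∃ s, IsLateOccurrence p k s then (Nat.find h : ℕ) else ⊤

variable {p : ℕ → Prop} {k : ℕ}

/-- The right side asks for no minimality, so it transfers between trajectories that agree up to
`i`. -/
lemma nthTime_le_iff {i : ℕ} :
    nthTime p k ≤ (i : WithTop ℕ) ↔ ∃ s ≤ i, IsLateOccurrence p k s := by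
  classical
  unfold nthTime
  split_ifs with h
  · rw [Nat.cast_le, Nat.find_le_iff]
  · simp only [top_le_iff, WithTop.natCast_ne_top, false_iff]
    rintro ⟨s, -, hs⟩
    exact h ⟨s, hs⟩

lemma isLateOccurrence_of_nthTime_eq {s : ℕ} (h : nthTime p k = (s : WithTop ℕ)) :
    IsLateOccurrence p k s := by
  classical
  unfold nthTime at h
  split_ifs at h with h'
  · rw [Nat.cast_inj] at h
    exact h ▸ Nat.find_spec h'
  · exact absurd h.symm (WithTop.coe_ne_top)

lemma IsLateOccurrence.mono {p' : ℕ → Prop} {s : ℕ} (h : IsLateOccurrence p k s)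
    (hp : ∀ u ≤ s, p u → p' u) : IsLateOccurrence p' k s := by
  classical
  obtain ⟨h1, h2, h3⟩ := h
  refine ⟨h1, hp s le_rfl h2, h3.trans (Finset.card_le_card fun u hu => ?_)⟩
  rw [Finset.mem_filter] at hu ⊢
  exact ⟨hu.1, hp u (Finset.mem_Ico.1 hu.1).2.le hu.2⟩

lemma one_le_nthTime : 1 ≤ nthTime p k := by
  rcases h : nthTime p k with _ | s
  · exact le_top
  · exact WithTop.coe_le_coe.2 (isLateOccurrence_of_nthTime_eq h).1

lemma nthTime_lt_succ (h : nthTime p k ≠ ⊤) : nthTime p k < nthTime p (k + 1) := by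
  classical
  rcases hs : nthTime p (k + 1) with _ | s
  · exact lt_top_iff_ne_top.2 h
  · obtain ⟨-, -, hcard⟩ := isLateOccurrence_of_nthTime_eq hs
    have hne : ((Finset.Ico 1 s).filter p).Nonempty := Finset.card_pos.1 (by omega)
    -- The last occurrence before `s` is still preceded by at least `k` others.
    set u := ((Finset.Ico 1 s).filter p).max' hne with hu
    have hmem := Finset.max'_mem _ hne
    rw [← hu, Finset.mem_filter, Finset.mem_Ico] at hmem
    refine lt_of_le_of_lt (nthTime_le_iff.2 ⟨u, le_rfl, hmem.1.1, hmem.2, ?_⟩)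
      (WithTop.coe_lt_coe.2 hmem.1.2)
    have hsub : ((Finset.Ico 1 s).filter p).erase u ⊆ (Finset.Ico 1 u).filter p := by
      intro v hv
      obtain ⟨hvu, hv⟩ := Finset.mem_erase.1 hv
      have hle := Finset.le_max' _ v hv
      rw [Finset.mem_filter, Finset.mem_Ico] at hv ⊢
      exact ⟨⟨hv.1.1, lt_of_le_of_ne hle hvu⟩, hv.2⟩
    have := Finset.card_le_card hsub
    rw [Finset.card_erase_of_mem (Finset.max'_mem _ hne)] at this
    omega

lemma nthTime_le_succ : nthTime p k ≤ nthTime p (k + 1) := by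
  by_cases h : nthTime p k = ⊤
  · have : nthTime p (k + 1) = ⊤ := by
      rcases hs : nthTime p (k + 1) with _ | s
      · rfl
      · obtain ⟨h1, h2, h3⟩ := isLateOccurrence_of_nthTime_eq hs
        have := (nthTime_le_iff (p := p) (k := k)).2 ⟨s, le_rfl, h1, h2, by omega⟩
        rw [h] at this
        exact absurd (top_le_iff.1 this) (WithTop.coe_ne_top)
    rw [this]
    exact le_top
  · exact (nthTime_lt_succ h).le

lemma nthTime_ne_top (h : ∃ᶠ s in atTop, p s) (k : ℕ) : nthTime p k ≠ ⊤ := by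
  classical
  suffices ∃ s, IsLateOccurrence p k s by
    rw [nthTime, dif_pos this]
    exact WithTop.coe_ne_top
  rw [frequently_atTop] at h
  induction k with
  | zero =>
    obtain ⟨s, hs, hp⟩ := h 1
    exact ⟨s, hs, hp, Nat.zero_le _⟩
  | succ k ih =>
    obtain ⟨s, hs, hp, hk⟩ := ih
    obtain ⟨u, hu, hpu⟩ := h (s + 1)
    refine ⟨u, by omega, hpu, ?_⟩
    have hsub : insert s ((Finset.Ico 1 s).filter p) ⊆ (Finset.Ico 1 u).filter p := by
      intro v hv
      rw [Finset.mem_insert, Finset.mem_filter, Finset.mem_Ico] at hv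
      rw [Finset.mem_filter, Finset.mem_Ico]
      rcases hv with rfl | ⟨hv, hpv⟩
      · exact ⟨⟨hs, by omega⟩, hp⟩
      · exact ⟨⟨hv.1, by omega⟩, hpv⟩
    have := Finset.card_le_card hsub
    rw [Finset.card_insert_of_notMem (by simp)] at this
    omega

end NthTime

/-! ### Measurability and filtrations -/

/-- An event described by finitely many actions and rewards is measurable with respect to any
σ-algebra for which these are. -/
lemma measurableSet_of_dependsOn {Ω : Type*} {m : MeasurableSpace Ω} {A : ℕ → Ω → Fin 2}
    {R : ℕ → Ω → Bool} {I J : Finset ℕ} (hA : ∀ i ∈ I, Measurable (A i))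
    (hR : ∀ i ∈ J, Measurable (R i)) {p : (ℕ → Fin 2) → (ℕ → Bool) → Prop}
    (hp : ∀ a a' r r', (∀ i ∈ I, a i = a' i) → (∀ i ∈ J, r i = r' i) → p a r → p a' r') :
    MeasurableSet {ω | p (fun t => A t ω) (fun t => R t ω)} := by
  classical
  let f : Ω → (I → Fin 2) × (J → Bool) := fun ω => (fun i => A i ω, fun i => R i ω)
  have hf : Measurable f :=
    (measurable_pi_lambda _ fun i : I => hA i.1 i.2).prodMk (measurable_pi_lambda _ fun i : J => hR i.1 i.2)
  -- Coordinates outside `I` and `J` get dummy values, which `p` ignores by `hp`.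
  let S : Set ((I → Fin 2) × (J → Bool)) := {x | p (fun i => if h : i ∈ I then x.1 ⟨i, h⟩ else 0)
    (fun i => if h : i ∈ J then x.2 ⟨i, h⟩ else true)}
  have hS : {ω | p (fun t => A t ω) (fun t => R t ω)} = f ⁻¹' S := by
    ext ω
    refine ⟨fun h => hp _ _ _ _ ?_ ?_ h, fun h => hp _ _ _ _ ?_ ?_ h⟩ <;>
    · intro i hi
      simp [f, hi]
  rw [hS]
  exact hf S.toFinite.measurableSet

/-- The predictable factor of a bet: `l` if arm `b` is pulled, and zero otherwise. -/
noncomputable def stake (l : ℝ) (b : Fin 2) (x : Fin 2) : ℝ := if x = b then l else 0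

lemma wager_eq_stake_mul_sub (μ : Fin 2 → ℝ) (l : ℝ) (b : Fin 2) (a : ℕ → Fin 2) (r : ℕ → Bool)
    (i : ℕ) : wager μ l b a r i =
      stake l b (a i) * (if r i = true then 1 else 0) - stake l b (a i) * μ b := by
  unfold wager stake
  split_ifs <;> ring

variable {Ω : Type*} [mΩ : MeasurableSpace Ω] {A : ℕ → Ω → Fin 2} {R : ℕ → Ω → Bool}
  {hA : ∀ t, Measurable (A t)} {hR : ∀ t, Measurable (R t)}

lemma measurable_action_history {i t : ℕ} (hi : 1 ≤ i) (hit : i < t) :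
    Measurable[history A R hA hR t] (A i) :=
  Measurable.mono (comap_measurable (A i))
    (le_sup_left.trans (le_iSup₂_of_le i (Finset.mem_Ico.2 ⟨hi, hit⟩) le_rfl)) le_rfl

lemma measurable_reward_history {i t : ℕ} (hi : 1 ≤ i) (hit : i < t) :
    Measurable[history A R hA hR t] (R i) :=
  Measurable.mono (comap_measurable (R i))
    (le_sup_right.trans (le_iSup₂_of_le i (Finset.mem_Ico.2 ⟨hi, hit⟩) le_rfl)) le_rfl

/-- The σ-algebra of this filtration at time `k` is generated by the observations made before
round `k + 1` and the action chosen in that round. -/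
def actionHistory (A : ℕ → Ω → Fin 2) (R : ℕ → Ω → Bool) (hA : ∀ t, Measurable (A t))
    (hR : ∀ t, Measurable (R t)) : Filtration ℕ mΩ where
  seq k := history A R hA hR (k + 1) ⊔ MeasurableSpace.comap (A (k + 1)) inferInstance
  mono' := monotone_nat_of_le_succ fun _ => sup_le
    (((history A R hA hR).mono (Nat.le_succ _)).trans le_sup_left)
    ((measurable_action_history (Nat.succ_pos _) (Nat.lt_succ_self _)).comap_le.trans le_sup_left)
  le' _ := sup_le ((history A R hA hR).le _) (hA _).comap_le

lemma measurable_action {i k : ℕ} (hi : 1 ≤ i) (hik : i ≤ k + 1) :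
    Measurable[actionHistory A R hA hR k] (A i) := by
  rcases hik.lt_or_eq with h | rfl
  · exact (measurable_action_history hi h).mono le_sup_left le_rfl
  · exact Measurable.mono (comap_measurable (A (k + 1))) le_sup_right le_rfl

lemma measurable_reward {i k : ℕ} (hi : 1 ≤ i) (hik : i ≤ k) :
    Measurable[actionHistory A R hA hR k] (R i) :=
  (measurable_reward_history hi (Nat.lt_succ_of_le hik)).mono le_sup_left le_rfl

/-- Being certified at `s ≤ n` involves only rounds before `s`, all contained in the history at `n`.
-/
lemma isStoppingTime_nthTime_certified (T k : ℕ) : IsStoppingTime (history A R hA hR)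
    (fun ω => nthTime (Certified T (fun t => A t ω) (fun t => R t ω)) k) := by
  intro n
  refine @measurableSet_of_dependsOn Ω (history A R hA hR n) A R (Finset.Ico 1 n)
    (Finset.Ico 1 n) (fun i hi => ?_) (fun i hi => ?_)
    (fun a r => nthTime (Certified T a r) k ≤ n) fun a a' r r' ha hr h => ?_
  · rw [Finset.mem_Ico] at hi
    exact measurable_action_history hi.1 hi.2
  · rw [Finset.mem_Ico] at hi
    exact measurable_reward_history hi.1 hi.2
  · obtain ⟨s, hsn, hs⟩ := nthTime_le_iff.1 h
    exact nthTime_le_iff.2 ⟨s, hsn, hs.mono fun u hu hcert =>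
      hcert.congr (fun i hi hi' => ha i (Finset.mem_Ico.2 ⟨hi, by omega⟩))
        (fun i hi hi' => hr i (Finset.mem_Ico.2 ⟨hi, by omega⟩))⟩

/-! ### Martingales, Borel–Cantelli and the almost sure statements -/

variable {P : Measure Ω} {μ : Fin 2 → ℝ}

lemma IsUCBRun.condExp_reward (hrun : IsUCBRun P μ A R hA hR) (k : ℕ) :
    P[Set.indicator {ω | R (k + 1) ω = true} (fun _ => (1 : ℝ)) | actionHistory A R hA hR k]
      =ᵐ[P] fun ω => μ (A (k + 1) ω) :=
  hrun.reward_law (k + 1) (Nat.succ_pos k)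

variable [IsProbabilityMeasure P]

lemma integrable_reward (hR : ∀ t, Measurable (R t)) (t : ℕ) :
    Integrable (Set.indicator {ω | R t ω = true} (fun _ => (1 : ℝ))) P :=
  (integrable_const _).indicator (hR t (measurableSet_singleton true))

lemma stronglyMeasurable_wealth (l : ℝ) (b : Fin 2) (n : ℕ) :
    StronglyMeasurable[actionHistory A R hA hR n]
      (fun ω => wealth μ l b (fun t => A t ω) (fun t => R t ω) n) := by
  refine Measurable.stronglyMeasurable ?_
  unfold wealth
  refine Finset.measurable_fun_prod _ fun i hi => ?_
  rw [Finset.mem_range] at hi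
  have h : Measurable[actionHistory A R hA hR n] fun ω => (A (i + 1) ω, R (i + 1) ω) :=
    (measurable_action (by omega) (by omega)).prodMk (measurable_reward (by omega) (by omega))
  exact (measurable_of_finite fun x : Fin 2 × Bool =>
    1 + if x.1 = b then l * ((if x.2 = true then 1 else 0) - μ b) else 0).comp h

lemma stronglyMeasurable_stake (l : ℝ) (b : Fin 2) (n : ℕ) :
    StronglyMeasurable[actionHistory A R hA hR n] (fun ω => stake l b (A (n + 1) ω)) :=
  ((measurable_of_finite (stake l b)).comp
    (measurable_action (Nat.succ_pos n) le_rfl)).stronglyMeasurable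

lemma integrable_wealth {l : ℝ} {b : Fin 2} (hμ : μ b ∈ Set.Ioo (0 : ℝ) 1) (hl : |l| ≤ 1 / 2)
    (hA : ∀ t, Measurable (A t)) (hR : ∀ t, Measurable (R t)) (n : ℕ) :
    Integrable (fun ω => wealth μ l b (fun t => A t ω) (fun t => R t ω) n) P := by
  refine Integrable.of_bound ((stronglyMeasurable_wealth (hA := hA) (hR := hR) l b n).mono
    ((actionHistory A R hA hR).le n)).aestronglyMeasurable (2 ^ n) (ae_of_all _ fun ω => ?_)
  rw [Real.norm_of_nonneg (wealth_nonneg hμ hl n)]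
  exact wealth_le_two_pow hμ hl n

/-- Given the past and the next action the stake is known, and it vanishes unless arm `b` is pulled,
when the reward has conditional mean `μ b`; every bet is therefore fair. -/
lemma IsUCBRun.martingale_wealth (hrun : IsUCBRun P μ A R hA hR) {l : ℝ} {b : Fin 2}
    (hμ : μ b ∈ Set.Ioo (0 : ℝ) 1) (hl : |l| ≤ 1 / 2) :
    Martingale (fun n ω => wealth μ l b (fun t => A t ω) (fun t => R t ω) n)
      (actionHistory A R hA hR) P := by
  refine martingale_nat (fun n => stronglyMeasurable_wealth l b n)
    (fun n => integrable_wealth hμ hl hA hR n) fun n => ?_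
  set W : Ω → ℝ := fun ω => wealth μ l b (fun t => A t ω) (fun t => R t ω) n with hW
  set s : Ω → ℝ := fun ω => stake l b (A (n + 1) ω) with hs
  set X : Ω → ℝ := Set.indicator {ω | R (n + 1) ω = true} (fun _ => (1 : ℝ)) with hX
  have hWm : StronglyMeasurable[actionHistory A R hA hR n] W := stronglyMeasurable_wealth l b n
  have hsm : StronglyMeasurable[actionHistory A R hA hR n] s := stronglyMeasurable_stake l b n
  have hle := (actionHistory A R hA hR).le n
  have hWi : Integrable W P := integrable_wealth hμ hl hA hR n
  have hXi : Integrable X P := integrable_reward hR (n + 1)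
  have hsb : ∀ ω, ‖s ω‖ ≤ |l| := fun ω => by
    simp only [hs, stake]
    split_ifs <;> simp
  have hXb : ∀ ω, ‖X ω‖ ≤ 1 := fun ω => by
    simp only [hX, Set.indicator]
    split_ifs <;> simp
  have hWs : Integrable (W * s) P :=
    hWi.mul_bdd (c := |l|) (hsm.mono hle).aestronglyMeasurable (ae_of_all _ hsb)
  have hWsX : Integrable (W * s * X) P :=
    hWs.mul_bdd (c := 1) hXi.aestronglyMeasurable (ae_of_all _ hXb)
  have hF : StronglyMeasurable[actionHistory A R hA hR n] (W - W * s * fun _ => μ b) :=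
    hWm.sub ((hWm.mul hsm).mul stronglyMeasurable_const)
  have hFi : Integrable (W - W * s * fun _ => μ b) P := hWi.sub (hWs.mul_const (μ b))
  have heq : (fun ω => wealth μ l b (fun t => A t ω) (fun t => R t ω) (n + 1)) =
      (W - W * s * fun _ => μ b) + W * s * X := by
    funext ω
    have hprod : wealth μ l b (fun t => A t ω) (fun t => R t ω) (n + 1) =
        W ω * (1 + wager μ l b (fun t => A t ω) (fun t => R t ω) (n + 1)) :=
      Finset.prod_range_succ _ _
    rw [hprod, wager_eq_stake_mul_sub]
    simp only [Pi.add_apply, Pi.sub_apply, Pi.mul_apply, hs, hX, Set.indicator_apply,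
      Set.mem_ofPred_eq]
    ring
  rw [heq]
  filter_upwards [condExp_add hFi hWsX (actionHistory A R hA hR n),
    condExp_mul_of_stronglyMeasurable_left (hWm.mul hsm) hWsX hXi, hrun.condExp_reward n]
    with ω h1 h2 h3
  rw [h1, Pi.add_apply, h2, condExp_of_stronglyMeasurable hle hF hFi, Pi.mul_apply, h3]
  simp only [Pi.sub_apply, Pi.mul_apply, hs, stake]
  split_ifs with h
  · rw [h]; ring
  · ring

/-- A nonnegative martingale is bounded in `L¹` by its initial mean, here one, so it converges
almost surely. -/
lemma IsUCBRun.ae_exists_wealth_le (hrun : IsUCBRun P μ A R hA hR) {l : ℝ} {b : Fin 2}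
    (hμ : μ b ∈ Set.Ioo (0 : ℝ) 1) (hl : |l| ≤ 1 / 2) :
    ∀ᵐ ω ∂P, ∃ C, ∀ n, wealth μ l b (fun t => A t ω) (fun t => R t ω) n ≤ C := by
  have hM := hrun.martingale_wealth hμ hl
  have hbdd : ∀ n, eLpNorm (fun ω => wealth μ l b (fun t => A t ω) (fun t => R t ω) n) 1 P ≤
      (1 : NNReal) := fun n => by
    rw [eLpNorm_one_eq_lintegral_enorm,
      ← ofReal_integral_norm_eq_lintegral_enorm (integrable_wealth hμ hl hA hR n)]
    have h1 : ∀ ω, ‖wealth μ l b (fun t => A t ω) (fun t => R t ω) n‖ =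
        wealth μ l b (fun t => A t ω) (fun t => R t ω) n := fun ω =>
      Real.norm_of_nonneg (wealth_nonneg hμ hl n)
    have h2 := integral_congr_ae (hM.condExp_ae_eq (Nat.zero_le n))
    rw [integral_condExp ((actionHistory A R hA hR).le 0)] at h2
    simp only [h1, h2]
    simp [wealth]
  filter_upwards [hM.submartingale.exists_ae_tendsto_of_bdd hbdd] with ω ⟨c, hc⟩
  obtain ⟨C, hC⟩ := hc.bddAbove_range
  exact ⟨C, fun n => hC ⟨n, rfl⟩⟩

/-- The strong law of large numbers for the empirical means of the arms. -/
lemma IsUCBRun.ae_tendsto_empMean (hrun : IsUCBRun P μ A R hA hR)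
    (hμ : ∀ b, μ b ∈ Set.Ioo (0 : ℝ) 1) :
    ∀ᵐ ω ∂P, ∀ b, Tendsto (empMean (fun t => A t ω) (fun t => R t ω) b) atTop (𝓝 (μ b)) := by
  have hl : ∀ k : ℕ, |(1 : ℝ) / (k + 2)| ≤ 1 / 2 := fun k => by
    rw [abs_of_pos (by positivity)]
    exact one_div_le_one_div_of_le (by norm_num) (by linarith [Nat.cast_nonneg (α := ℝ) k])
  have h : ∀ᵐ ω ∂P, ∀ (b : Fin 2) (k : ℕ),
      (∃ C, ∀ n, wealth μ (1 / (k + 2)) b (fun t => A t ω) (fun t => R t ω) n ≤ C) ∧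
      ∃ C, ∀ n, wealth μ (-(1 / (k + 2))) b (fun t => A t ω) (fun t => R t ω) n ≤ C := by
    rw [ae_all_iff]
    intro b
    rw [ae_all_iff]
    intro k
    exact (hrun.ae_exists_wealth_le (hμ b) (hl k)).and
      (hrun.ae_exists_wealth_le (hμ b) ((abs_neg _).trans_le (hl k)))
  filter_upwards [h, hrun.follows] with ω h hf b
  exact tendsto_empMean_of_wealth_le (hμ b) (hf.tendsto_visits b) (h b)

/-- Among infinitely many occasions at which arm `b` is pulled, infinitely many are successful. -/
lemma IsUCBRun.ae_frequently_success (hrun : IsUCBRun P μ A R hA hR) {b : Fin 2} (hμ : 0 < μ b)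
    {B : ℕ → Set Ω} (hB : ∀ k, MeasurableSet[actionHistory A R hA hR k] (B k))
    (hBA : ∀ k, ∀ ω ∈ B k, A (k + 1) ω = b) :
    ∀ᵐ ω ∂P, (∃ᶠ k in atTop, ω ∈ B k) → ∃ᶠ k in atTop, ω ∈ B k ∧ R (k + 1) ω = true := by
  -- The shift by one makes `s (k + 1)` measurable at level `k + 1` while its conditional
  -- probability is taken at level `k`. There it equals `μ b` on `B k`, so these probabilities sum
  -- to infinity whenever `B k` recurs.
  let s : ℕ → Set Ω := fun n => n.casesOn ∅ fun k => B k ∩ {ω | R (k + 1) ω = true}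
  have hs : ∀ n, MeasurableSet[actionHistory A R hA hR n] (s n) := by
    rintro (_ | k)
    · exact @MeasurableSet.empty Ω (actionHistory A R hA hR 0)
    · exact ((actionHistory A R hA hR).mono (Nat.le_succ k) _ (hB k)).inter
        (measurable_reward (Nat.succ_pos k) le_rfl (measurableSet_singleton true))
  have hcond : ∀ k, P[(s (k + 1)).indicator (1 : Ω → ℝ) | actionHistory A R hA hR k] =ᵐ[P]
      (B k).indicator fun _ => μ b := fun k => by
    have h1 : (s (k + 1)).indicator (1 : Ω → ℝ) =
        (B k).indicator ({ω | R (k + 1) ω = true}.indicator fun _ => (1 : ℝ)) := by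
      rw [Set.indicator_indicator]
      rfl
    rw [h1]
    filter_upwards [condExp_indicator (integrable_reward hR (k + 1)) (hB k),
      hrun.condExp_reward k] with ω h2 h3
    rw [h2]
    by_cases hω : ω ∈ B k
    · rw [Set.indicator_of_mem hω, Set.indicator_of_mem hω, h3, hBA k ω hω]
    · rw [Set.indicator_of_notMem hω, Set.indicator_of_notMem hω]
  filter_upwards [ae_mem_limsup_atTop_iff P hs, ae_all_iff.2 hcond] with ω hiff hcond hfreq
  have hsum : Tendsto (fun n => ∑ k ∈ Finset.range n, (B k).indicator (fun _ => μ b) ω)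
      atTop atTop := by
    have hmem : ω ∈ limsup B atTop := mem_limsup_iff_frequently_mem.2 hfreq
    rw [Set.limsup_eq_tendsto_sum_indicator_atTop hμ] at hmem
    exact hmem
  simp only [hcond] at hiff
  have := mem_limsup_iff_frequently_mem.1 (hiff.2 hsum)
  rw [← map_add_atTop_eq_nat 1, frequently_map] at this
  exact this

/-- Runs are lengthened by one success at a time: a run of length `m` includes the choice of arm `1`
in the current round, so infinitely many such runs see a success there, after which UCB stays on arm
`1`. -/
lemma IsUCBRun.ae_frequently_winningRun (hrun : IsUCBRun P μ A R hA hR)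
    (hμ_mem : ∀ b, μ b ∈ Set.Ioo (0 : ℝ) 1) (hμ : μ 1 < μ 0) {c : ℝ} (hc : 0 < c)
    (hc' : 3 * c < 1 - μ 1 - (μ 0 - μ 1) / 2) {Q m : ℕ} (hm : m ≤ Q) :
    ∀ᵐ ω ∂P, ∃ᶠ t in atTop, WinningRun c Q m (fun t => A t ω) (fun t => R t ω) t := by
  induction m with
  | zero =>
    filter_upwards [hrun.follows, hrun.ae_tendsto_empMean hμ_mem] with ω hf hlim
    refine ((hf.frequently_goodStart hlim hμ (by linarith [(hμ_mem 0).2, (hμ_mem 1).1]) hc hc'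
      Q).and_eventually (eventually_ge_atTop 1)).mono ?_
    rintro t ⟨⟨hg, h1⟩, ht⟩
    refine ⟨t, ht, rfl, hg, fun i hi hi' => ?_, fun i hi hi' => absurd hi' (by omega)⟩
    obtain rfl : i = t := by omega
    exact h1
  | succ m ih =>
    let B : ℕ → Set Ω := fun k =>
      {ω | WinningRun c Q m (fun t => A t ω) (fun t => R t ω) (k + 1)}
    have hB : ∀ k, MeasurableSet[actionHistory A R hA hR k] (B k) := fun k => by
      refine @measurableSet_of_dependsOn Ω (actionHistory A R hA hR k) A R (Finset.Icc 1 (k + 1))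
        (Finset.Icc 1 k) (fun i hi => ?_) (fun i hi => ?_)
        (fun a r => WinningRun c Q m a r (k + 1)) fun a a' r r' ha hr h => ?_
      · rw [Finset.mem_Icc] at hi
        exact measurable_action hi.1 hi.2
      · rw [Finset.mem_Icc] at hi
        exact measurable_reward hi.1 hi.2
      · exact h.congr (fun i hi hi' => ha i (Finset.mem_Icc.2 ⟨hi, hi'⟩))
          (fun i hi hi' => hr i (Finset.mem_Icc.2 ⟨hi, by omega⟩))
    filter_upwards [ih (by omega), hrun.follows, hrun.ae_frequently_success (hμ_mem 1).1 hB
      fun k ω hω => WinningRun.action_eq_one hω] with ω hω hf hsucc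
    rw [← map_add_atTop_eq_nat 1, frequently_map] at hω
    have h2 := (hsucc hω).mono fun k hk => WinningRun.succ hc hf (by omega) hk.1 hk.2
    -- `B k` concerns round `k + 1`, and the lengthened run ends one round later.
    exact (tendsto_add_atTop_nat 2).frequently h2

lemma IsUCBRun.ae_frequently_certified (hrun : IsUCBRun P μ A R hA hR)
    (hμ_mem : ∀ b, μ b ∈ Set.Ioo (0 : ℝ) 1) (hμ : μ 1 < μ 0) (T : ℕ) :
    ∀ᵐ ω ∂P, ∃ᶠ t in atTop, Certified T (fun t => A t ω) (fun t => R t ω) t := by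
  have h0 := (hμ_mem 0).2
  obtain ⟨c, hc, hc'⟩ : ∃ c : ℝ, 0 < c ∧ 3 * c < 1 - μ 1 - (μ 0 - μ 1) / 2 :=
    ⟨(1 - μ 1 - (μ 0 - μ 1) / 2) / 4, by linarith, by linarith⟩
  -- `M` successes, worth `3 * c` each, must pay for `T` failures at `3 / 2` each and leave the
  -- margin `2 * c`.
  obtain ⟨M, hM⟩ := exists_nat_ge ((2 * c + 3 / 2 * T) / (3 * c))
  rw [div_le_iff₀ (by positivity), mul_comm (M : ℝ)] at hM
  filter_upwards [hrun.ae_frequently_winningRun hμ_mem hμ hc hc' (Nat.le_add_right M T)] with ω hω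
  exact hω.mono fun t ht => ht.certified hc hM

end Bandit

theorem mainTheorem9 {Ω : Type*} [MeasurableSpace Ω]
    (P : MeasureTheory.Measure Ω) [MeasureTheory.IsProbabilityMeasure P]
    (μ : Fin 2 → ℝ) (hμ_mem : ∀ b, μ b ∈ Set.Ioo (0 : ℝ) 1) (hμ : μ 1 < μ 0)
    (A : ℕ → Ω → Fin 2) (R : ℕ → Ω → Bool)
    (hA : ∀ t, Measurable (A t)) (hR : ∀ t, Measurable (R t))
    (hrun : Bandit.IsUCBRun P μ A R hA hR)
    (T : ℕ) (hT : 0 < T) :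
    ∃ σ : ℕ → Ω → WithTop ℕ,
      (∀ k, MeasureTheory.IsStoppingTime (Bandit.history A R hA hR) (σ k)) ∧
      (∀ k ω, 1 ≤ σ k ω) ∧
      (∀ k ω, σ k ω ≤ σ (k + 1) ω ∧ (σ k ω ≠ ⊤ → σ k ω < σ (k + 1) ω)) ∧
      (∀ k, ∀ᵐ ω ∂P, σ k ω ≠ ⊤) ∧
      (∀ k, ∀ᵐ ω ∂P, ∀ s : ℕ, σ k ω = (s : WithTop ℕ) →
        Bandit.pseudoRegret μ (fun t => A t ω) s T = (μ 0 - μ 1) * (T : ℝ) ∧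
        ∀ (a : ℕ → Fin 2) (r : ℕ → Bool),
          (∀ i, 1 ≤ i → i < s → a i = A i ω ∧ r i = R i ω) →
          Bandit.FollowsUCB a r →
          Bandit.pseudoRegret μ a s T = (μ 0 - μ 1) * (T : ℝ)) := by
  refine ⟨fun k ω => Bandit.nthTime (Bandit.Certified T (fun t => A t ω) (fun t => R t ω)) k,
    fun k => Bandit.isStoppingTime_nthTime_certified T k, fun k ω => Bandit.one_le_nthTime,
    fun k ω => ⟨Bandit.nthTime_le_succ, Bandit.nthTime_lt_succ⟩, fun k => ?_, fun k => ?_⟩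
  · filter_upwards [hrun.ae_frequently_certified hμ_mem hμ T] with ω hω
    exact Bandit.nthTime_ne_top hω k
  · filter_upwards [hrun.follows] with ω hf s hs
    have hcert := (Bandit.isLateOccurrence_of_nthTime_eq hs).2.1
    exact ⟨hcert.pseudoRegret_eq μ hf fun i _ _ => ⟨rfl, rfl⟩,
      fun a r hagree hf' => hcert.pseudoRegret_eq μ hf' hagree⟩
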